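/- Let $A\in\mathbb R^{n\times n}$, $b,c\in\mathbb R^n$, and let $\mathbf G=[g_{ij}]\in\mathbb R^{N\times N}$ satisfy $g_{ij}\ge 0$ for all $i\ne j$. Consider the network of $N$ identical LTI SISO nodes $$\dot x_i(t)=Ax_i(t)+b\Big(\sum_{k=1}^N g_{ik}\,y_k(t)+w_i(t)\Big),\qquad y_i(t)=c^Tx_i(t),\qquad i=1,\dots,N,$$ and assume that its state matrix $I_N\otimes A+\mathbf G\otimes bc^T$ is Hurwitz. Assume: (A1) $w_1,\dots,w_N$ are (measurable, real-valued, finite-variance) mutually uncorrelated zero-mean wide-sense stationary processes with the same autocorrelation function $R_w(\tau)=\mathbb E(w_i(t)w_i(t+\tau))$, which is integrable; write $S_w(\omega)=\int_{\mathbb R}R_w(\tau)e^{-\mathbf j\omega\tau}\,d\tau$ for their common power spectral density. (A2) There is $\Omega>0$ with $S_w(\omega)>0$ for all $\omega\in(-\Omega,\Omega)$. Fix a node $j$. The dynamics grounded at $j$ is the network of the same form on the nodes $i\ne j$, with $\mathbf G$ replaced by the matrix $\widetilde{\mathbf G}_j$ obtained by deleting row and column $j$, and with input noise $(w_i)_{i\neq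 j}$; assume that $I_{N-1}\otimes A+\widetilde{\mathbf G}_j\otimes bc^T$ is Hurwitz as well. Consider wide-sense stationary state processes on $t\in\mathbb R$ that solve the network dynamics and the grounded dynamics pathwise (almost surely, in integrated form), and let $y_i$ and $\widetilde y_i$ be their outputs. Let $\mathbf S(\omega)=[S_{y_iy_k}(\omega)]_{i,k}$ and $\widetilde{\mathbf S}_j(\omega)=[S_{\widetilde y_i\widetilde y_k}(\omega)]_{i,k\neq j}$ be the matrices of cross-power spectral densities of the outputs, where $S_{uv}(\omega)=\int_{\mathbb R}\mathbb E(u(t)v(t-\tau))e^{-\mathbf j\omega\tau}\,d\tau$. Let $\omega_0\in(-\Omega,\Omega)$ be such that $c^T\operatorname{adj}(\mathbf j\omega_0I_n-A)\,b\neq0$; when $\mathbf j\omega_0$ is not an eigenvalue of $A$, this says that the nodal transfer function $h(\mathbf j\omega)=c^T(\mathbf j\omega I_n-A)^{-1}b$ does not vanish at $\omega_0$. Then all the output correlation functions above are integrable, the matrices $\mathbf S(\omega_0)$ and $\widetilde{\mathbf S}_j(\omega_0)$ are invertible, and for every node $i\ne j$ $$g_{ji}=\Big[S_w(\omega_0)\Big([\mathbf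 S^{-1}(\omega_0)]_{ii}-[\widetilde{\mathbf S}_j^{-1}(\omega_0)]_{ii}\Big)\Big]^{1/2},$$ where the rows and columns of $\widetilde{\mathbf S}_j$ are labelled by the nodes $i\neq j$ (so that with consecutive numbering $1,\dots,N-1$ the entry is $[\widetilde{\mathbf S}_j^{-1}(\omega_0)]_{ii}$ for $i<j$ and $[\widetilde{\mathbf S}_j^{-1}(\omega_0)]_{i-1,i-1}$ for $i>j$). -/

import Mathlib

open MeasureTheory
open scoped Kronecker ComplexOrder

noncomputable section

/-! ### Second-order quantities of stochastic processes indexed by real time -/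

/-- The expectation `𝔼(x(t) y(t - τ))`, which may depend on the time `t`. -/
def correlationAt {Ω : Type*} [MeasurableSpace Ω] (P : Measure Ω)
    (x y : ℝ → Ω → ℝ) (t τ : ℝ) : ℝ :=
  ∫ o, x t o * y (t - τ) o ∂P

/-- The cross-correlation function `R_{xy}(τ) = 𝔼(x(t) y(t - τ))`. It is only used for jointly
wide-sense stationary processes, for which the time `t` (here `t = 0`) is immaterial. -/
def crossCorrelation {Ω : Type*} [MeasurableSpace Ω] (P : Measure Ω)
    (x y : ℝ → Ω → ℝ) (τ : ℝ) : ℝ :=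
  correlationAt P x y 0 τ

/-- The Fourier transform `∫ R(τ) exp(-𝐣 ω τ) dτ` of a correlation function, at the angular
frequency `ω`. -/
def spectralDensity (R : ℝ → ℝ) (ω : ℝ) : ℂ :=
  ∫ τ : ℝ, Complex.exp (-(Complex.I * ω * τ)) * (R τ : ℂ)

/-- The matrix `[S_{y_i y_k}(ω)]` of cross-power spectral densities of a vector process. -/
def cpsdMatrix {Ω ι : Type*} [MeasurableSpace Ω] (P : Measure Ω)
    (y : ι → ℝ → Ω → ℝ) (ω : ℝ) : Matrix ι ι ℂ :=
  Matrix.of fun i k => spectralDensity (crossCorrelation P (y i) (y k)) ω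

/-- The components of `x` are jointly wide-sense stationary: square integrable, with means that do
not depend on time and with correlations `𝔼(x_p(t) x_q(t - τ))` that depend on `τ` only. -/
structure IsJointlyWSS {Ω κ : Type*} [MeasurableSpace Ω] (P : Measure Ω)
    (x : κ → ℝ → Ω → ℝ) : Prop where
  memLp : ∀ p t, MemLp (x p t) 2 P
  mean_eq : ∀ p s t, ∫ o, x p s o ∂P = ∫ o, x p t o ∂P
  correlation_eq : ∀ p q s t τ, correlationAt P (x p) (x q) s τ = correlationAt P (x p) (x q) t τ

/-- The input noise consists of (measurable) uncorrelated zero-mean wide-sense stationary processes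
with the same autocorrelation function `R`, which has a Fourier transform. -/
structure IsInputNoise {Ω ι : Type*} [MeasurableSpace Ω] (P : Measure Ω)
    (w : ι → ℝ → Ω → ℝ) (R : ℝ → ℝ) : Prop where
  measurable : ∀ i, Measurable fun p : ℝ × Ω => w i p.1 p.2
  memLp : ∀ i t, MemLp (w i t) 2 P
  zero_mean : ∀ i t, ∫ o, w i t o ∂P = 0
  uncorrelated : ∀ i k, i ≠ k → ∀ s t, ∫ o, w i s o * w k t o ∂P = 0
  autocorrelation : ∀ i t τ, ∫ o, w i t o * w i (t + τ) o ∂P = R τ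
  integrable : Integrable R

/-- `(-W, W)` is a nonempty excitation frequency interval of `w`: the power spectral density of
every component is (real and) positive on it. -/
def IsExcitationInterval {Ω ι : Type*} [MeasurableSpace Ω] (P : Measure Ω)
    (w : ι → ℝ → Ω → ℝ) (W : ℝ) : Prop :=
  0 < W ∧ ∀ ω ∈ Set.Ioo (-W) W, ∀ i, 0 < spectralDensity (crossCorrelation P (w i) (w i)) ω

/-! ### The networked dynamical system -/

/-- The network state matrix `I ⊗ A + G ⊗ b cᵀ`; the coordinate `(i, k)` of the network state is the
`k`-th coordinate of the state of node `i`. -/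
def networkStateMatrix {ι : Type*} [DecidableEq ι] {n : ℕ} (A : Matrix (Fin n) (Fin n) ℝ)
    (b c : Fin n → ℝ) (G : Matrix ι ι ℝ) : Matrix (ι × Fin n) (ι × Fin n) ℝ :=
  (1 : Matrix ι ι ℝ) ⊗ₖ A + G ⊗ₖ Matrix.vecMulVec b c

/-- A real matrix is Hurwitz if all its complex eigenvalues have negative real part. -/
def IsHurwitz {κ : Type*} [Fintype κ] [DecidableEq κ] (M : Matrix κ κ ℝ) : Prop :=
  ∀ z ∈ spectrum ℂ (M.map Complex.ofReal), z.re < 0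

/-- The right-hand side `(I ⊗ A + G ⊗ b cᵀ) x + (I ⊗ b) w` of the network dynamics. -/
def networkField {ι : Type*} [Fintype ι] [DecidableEq ι] {n : ℕ} (A : Matrix (Fin n) (Fin n) ℝ)
    (b c : Fin n → ℝ) (G : Matrix ι ι ℝ) (x : ι × Fin n → ℝ) (w : ι → ℝ) : ι × Fin n → ℝ :=
  fun p => (networkStateMatrix A b c G).mulVec x p + b p.2 * w p.1

/-- `x` is a stationary response of the network dynamics
`x' = (I ⊗ A + G ⊗ b cᵀ) x + (I ⊗ b) w` to the input `w`: a jointly wide-sense stationary process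
on the whole time line, almost all of whose paths are continuous and solve the differential
equation in its integrated form. -/
structure IsStationaryResponse {Ω ι : Type*} [MeasurableSpace Ω] [Fintype ι] [DecidableEq ι]
    {n : ℕ} (P : Measure Ω) (A : Matrix (Fin n) (Fin n) ℝ) (b c : Fin n → ℝ) (G : Matrix ι ι ℝ)
    (w : ι → ℝ → Ω → ℝ) (x : ι × Fin n → ℝ → Ω → ℝ) : Prop where
  wss : IsJointlyWSS P x
  continuous : ∀ᵐ o ∂P, ∀ p, Continuous fun t => x p t o
  solves : ∀ᵐ o ∂P, ∀ p s t,
    IntervalIntegrable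
      (fun u => networkField A b c G (fun q => x q u o) (fun i => w i u o) p) volume s t ∧
    x p t o - x p s o =
      ∫ u in s..t, networkField A b c G (fun q => x q u o) (fun i => w i u o) p

/-- The network output `y = (I ⊗ cᵀ) x`, that is, `y_i = cᵀ x_i`. -/
def networkOutput {Ω ι : Type*} {n : ℕ} (c : Fin n → ℝ) (x : ι × Fin n → ℝ → Ω → ℝ) :
    ι → ℝ → Ω → ℝ :=
  fun i t o => ∑ k, c k * x (i, k) t o

/-- The connectivity matrix of the dynamics grounded at node `j`: row and column `j` are removed.
The remaining nodes keep their names. -/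
def groundedMatrix {ι : Type*} (G : Matrix ι ι ℝ) (j : ι) :
    Matrix {k : ι // k ≠ j} {k : ι // k ≠ j} ℝ :=
  G.submatrix Subtype.val Subtype.val

/-- The noise input of the dynamics grounded at node `j`: entry `j` is removed. -/
def groundedInput {Ω ι : Type*} (w : ι → ℝ → Ω → ℝ) (j : ι) :
    {k : ι // k ≠ j} → ℝ → Ω → ℝ :=
  fun k => w k

/-- The numerator `cᵀ adj(z I - A) b` of the nodal transfer function
`h(z) = cᵀ (z I - A)⁻¹ b = cᵀ adj(z I - A) b / det(z I - A)`. -/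
def nodalNumerator {n : ℕ} (A : Matrix (Fin n) (Fin n) ℝ) (b c : Fin n → ℝ) (z : ℂ) : ℂ :=
  (fun k => (c k : ℂ)) ⬝ᵥ
    (Matrix.adjugate (z • (1 : Matrix (Fin n) (Fin n) ℂ) - A.map Complex.ofReal)).mulVec
      (fun k => (b k : ℂ))

end

/-!
The spectral density matrix of the outputs is `S = S_w H Hᴴ`, where `H` is the transfer matrix of the
network at `𝐣 ω₀`. As `H⁻¹ = h⁻¹ I - G`, the diagonal entry of `S⁻¹ = S_w⁻¹ (H⁻¹)ᴴ H⁻¹` at node `i` is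
`S_w⁻¹ ∑ k, |(h⁻¹ I - G) k i|²`. Grounding node `j` deletes exactly the summand `k = j`, which for
`i ≠ j` is `(G j i)²`. The algebra is `outputTransfer_mul_inverseTransfer` and
`conjTranspose_mul_inverseTransfer_apply`; it uses `h⁻¹ = det(z - A) / (cᵀ adj(z - A) b)`, so that
eigenvalues of `A` on the imaginary axis do no harm.

The spectral formula `IsStationaryResponse.cpsdMatrix_eq` is obtained from second moments alone. For
every square integrable `Z` the function `t ↦ 𝔼(x(t) Z)` is a bounded solution on the whole line of
the network equation driven by `𝔼(w(t) Z)`: this is Fubini's theorem applied to the integrated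
equation (`isBoundedSolution_expectation`), the joint measurability of `x` coming from the continuity
of its paths. For a Hurwitz matrix such a solution is unique, it is integrable if the forcing is, and
its Fourier transform is the resolvent applied to that of the forcing. Choosing `Z = w_i(s)` shows
that input and state are jointly stationary and gives their cross-spectra; choosing `Z = x_q(0)`, for
which the forcing is now known, gives the spectra of the states.

Integrability and uniqueness of bounded solutions are reduced to scalar equations `g' = z g + φ`,
`re z < 0`, by splitting off the factors `M - z` of the characteristic polynomial one at a time with
the Cayley–Hamilton theorem (`Submodule.eq_top_of_vecMul_sub_mem`), so that no matrix exponential is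
needed.
-/

/-! ### Primitives of locally integrable functions -/

/-- `g` is a primitive of the locally integrable function `ψ`: it solves `g' = ψ` on the whole line
in the integrated form. -/
def IsPrimitive (g ψ : ℝ → ℂ) : Prop :=
  ∀ s t, IntervalIntegrable ψ volume s t ∧ g t - g s = ∫ u in s..t, ψ u

namespace IsPrimitive

variable {g ψ : ℝ → ℂ}

theorem eq_add_integral (h : IsPrimitive g ψ) (s t : ℝ) : g t = g s + ∫ u in s..t, ψ u := by
  rw [← (h s t).2]; ring

theorem continuous (h : IsPrimitive g ψ) : Continuous g := by
  rw [funext (h.eq_add_integral 0)]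
  exact continuous_const.add
    (intervalIntegral.continuous_primitive (fun a b => (h a b).1) 0)

theorem const_mul (h : IsPrimitive g ψ) (z : ℂ) :
    IsPrimitive (fun t => z * g t) (fun t => z * ψ t) := fun s t =>
  ⟨(h s t).1.const_mul z, by
    rw [intervalIntegral.integral_const_mul, ← (h s t).2]; ring⟩

theorem sum {ι : Type*} (S : Finset ι) {g ψ : ι → ℝ → ℂ}
    (h : ∀ i ∈ S, IsPrimitive (g i) (ψ i)) :
    IsPrimitive (fun t => ∑ i ∈ S, g i t) (fun t => ∑ i ∈ S, ψ i t) := fun s t => by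
  refine ⟨?_, ?_⟩
  · have := IntervalIntegrable.sum S (fun i hi => (h i hi s t).1)
    simpa only [Finset.sum_fn] using this
  · rw [intervalIntegral.integral_finsetSum (fun i hi => (h i hi s t).1),
      ← Finset.sum_sub_distrib]
    exact Finset.sum_congr rfl fun i hi => (h i hi s t).2

theorem absolutelyContinuousOnInterval (h : IsPrimitive g ψ) (a b : ℝ) :
    AbsolutelyContinuousOnInterval g a b := by
  have hre : IntervalIntegrable (fun u => (ψ u).re) volume a b :=
    ⟨(h a b).1.1.re, (h a b).1.2.re⟩
  have him : IntervalIntegrable (fun u => (ψ u).im) volume a b :=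
    ⟨(h a b).1.1.im, (h a b).1.2.im⟩
  have hconst : ∀ z : ℂ, AbsolutelyContinuousOnInterval (fun _ : ℝ => z) a b := fun z =>
    (contDiffOn_const (c := z)).absolutelyContinuousOnInterval
  have key := (hconst (g a)).add
    (((hre.absolutelyContinuousOnInterval_intervalIntegral Set.left_mem_uIcc).smul (hconst 1)).add
    ((him.absolutelyContinuousOnInterval_intervalIntegral Set.left_mem_uIcc).smul
      (hconst Complex.I)))
  refine (?_ : _ = g) ▸ key
  ext1 t
  have h1 := intervalIntegral.intervalIntegral_re (h a t).1
  have h2 := intervalIntegral.intervalIntegral_im (h a t).1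
  simp only [RCLike.re_to_complex, RCLike.im_to_complex] at h1 h2
  simp only [Pi.add_apply, Pi.smul_apply', h1, h2]
  rw [h.eq_add_integral a t]
  congr 1
  apply Complex.ext <;> simp

/-- The product rule for `exp (z t) g(t)`, for a merely absolutely continuous `g`. -/
theorem exp_mul (h : IsPrimitive g ψ) (z : ℂ) :
    IsPrimitive (fun t => Complex.exp (z * t) * g t)
      (fun t => Complex.exp (z * t) * (z * g t + ψ t)) := by
  have hexp : Continuous fun t : ℝ => Complex.exp (z * t) := by fun_prop
  have hint : ∀ s t, IntervalIntegrable (fun t : ℝ => Complex.exp (z * t) * (z * g t + ψ t))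
      volume s t := fun s t =>
    (((continuous_const.mul h.continuous).intervalIntegrable s t).add
      (h s t).1).continuousOn_mul hexp.continuousOn
  intro s t
  refine ⟨hint s t, ?_⟩
  have hprim : IsPrimitive
      (fun x => ∫ u in s..x, Complex.exp (z * u) * (z * g u + ψ u))
      (fun t => Complex.exp (z * t) * (z * g t + ψ t)) := fun a b =>
    ⟨hint a b, intervalIntegral.integral_interval_sub_left (hint s b) (hint s a)⟩
  have hexpAC : AbsolutelyContinuousOnInterval (fun t : ℝ => Complex.exp (z * t)) s t := by
    apply ContDiffOn.absolutelyContinuousOnInterval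
    exact (Complex.contDiff_exp.comp
      (contDiff_const.mul Complex.ofRealCLM.contDiff)).contDiffOn
  -- the difference of the two sides is absolutely continuous with derivative zero
  have hAC := (hexpAC.smul (h.absolutelyContinuousOnInterval s t)).sub
    (hprim.absolutelyContinuousOnInterval s t)
  obtain ⟨C, hC⟩ := hAC.const_of_ae_hasDerivAt_zero (by
    filter_upwards [(h s t).1.ae_hasDerivAt_integral, (hint s t).ae_hasDerivAt_integral]
      with x h1 h2 hx
    have d1 : HasDerivAt g (ψ x) x := by
      rw [funext (h.eq_add_integral s)]
      exact (h1 hx s Set.left_mem_uIcc).const_add (g s)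
    have d0 : HasDerivAt (fun t : ℝ => Complex.exp (z * t)) (Complex.exp (z * x) * z) x := by
      simpa using (((hasDerivAt_id (x : ℂ)).const_mul z).cexp).comp_ofReal
    have d := (d0.mul d1).sub (h2 hx s Set.left_mem_uIcc)
    have hz : Complex.exp (z * x) * z * g x + Complex.exp (z * x) * ψ x -
        Complex.exp (z * x) * (z * g x + ψ x) = 0 := by ring
    rw [hz] at d
    exact d)
  have e1 := hC t Set.right_mem_uIcc
  have e2 := hC s Set.left_mem_uIcc
  simp only [Pi.sub_apply, Pi.mul_apply, smul_eq_mul, intervalIntegral.integral_same] at e1 e2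
  linear_combination e1 - e2

/-- Integration by parts for the Fourier integral. -/
theorem fourier_eq (h : IsPrimitive g ψ) (hg : Integrable g) (hψ : Integrable ψ) (ω : ℝ) :
    ∫ t : ℝ, Complex.exp (-(Complex.I * ω * t)) * ψ t =
      Complex.I * ω * ∫ t : ℝ, Complex.exp (-(Complex.I * ω * t)) * g t := by
  have hnorm : ∀ t : ℝ, ‖Complex.exp (-(Complex.I * ω * t))‖ = 1 := fun t => by
    rw [Complex.norm_exp]; simp
  have hI : ∀ {f : ℝ → ℂ}, Integrable f →
      Integrable fun t : ℝ => Complex.exp (-(Complex.I * ω * t)) * f t := fun hf =>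
    hf.bdd_mul (c := 1) (by fun_prop) (Filter.Eventually.of_forall fun t => (hnorm t).le)
  have h' := h.exp_mul (-(Complex.I * ω))
  simp only [neg_mul] at h'
  have hI' : Integrable fun t : ℝ =>
      Complex.exp (-(Complex.I * ω * t)) * (-(Complex.I * ω * g t) + ψ t) :=
    hI (((hg.const_mul (Complex.I * ω)).neg).add hψ)
  -- the boundary terms are integrable and converge, so they tend to zero
  have hlim := intervalIntegral_tendsto_integral hI' Filter.tendsto_neg_atTop_atBot Filter.tendsto_id
  simp only [id, ← (h' _ _).2] at hlim
  have hzero := IntegrableAtFilter.eq_zero_of_tendsto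
    (((hI hg).sub (hI hg).comp_neg).integrableAtFilter Filter.atTop) (by
      intro s hs
      obtain ⟨b, hb⟩ := Filter.mem_atTop_sets.1 hs
      rw [← top_le_iff, ← Real.volume_Ici (a := b)]
      exact measure_mono hb) hlim
  have hsplit : ∀ t : ℝ, Complex.exp (-(Complex.I * ω * t)) * (-(Complex.I * ω * g t) + ψ t) =
      Complex.exp (-(Complex.I * ω * t)) * ψ t -
        Complex.I * ω * (Complex.exp (-(Complex.I * ω * t)) * g t) := fun t => by ring
  simp only [hsplit] at hzero
  rw [integral_sub (hI hψ) ((hI hg).const_mul _), integral_const_mul] at hzero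
  exact sub_eq_zero.1 hzero

/-- A bounded solution of `g' = z g + φ` with `re z < 0` is dominated by the convolution of `‖φ‖`
with the kernel `exp (re z r)`, `r ≥ 0`: the influence of the initial time `s` dies out as
`s → -∞`. -/
theorem norm_le_convolution {z : ℂ} (hz : z.re < 0) {φ : ℝ → ℂ} (hφ : Integrable φ)
    (h : IsPrimitive g fun t => z * g t + φ t) {C : ℝ} (hC : ∀ t, ‖g t‖ ≤ C) (t : ℝ) :
    ‖g t‖ ≤ convolution (fun u => ‖φ u‖)
      ((Set.Ici (0 : ℝ)).indicator fun r => Real.exp (z.re * r))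
      (ContinuousLinearMap.mul ℝ ℝ) volume t := by
  set k : ℝ → ℝ := (Set.Ici (0 : ℝ)).indicator fun r => Real.exp (z.re * r) with hk
  have hk0 : ∀ r, 0 ≤ k r := fun r => Set.indicator_nonneg (fun _ _ => (Real.exp_pos _).le) r
  have hk1 : ∀ r, k r ≤ 1 := fun r => by
    refine Set.indicator_le' (fun r hr => ?_) (fun _ _ => zero_le_one) r
    exact Real.exp_le_one_iff.2 (mul_nonpos_of_nonpos_of_nonneg hz.le hr)
  have hkm : Measurable k := (by fun_prop : Measurable fun r => Real.exp (z.re * r)).indicator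
    measurableSet_Ici
  have hint : Integrable fun u => ‖φ u‖ * k (t - u) := by
    refine hφ.norm.mul_bdd (c := 1)
      (hkm.comp (measurable_const.sub measurable_id)).aestronglyMeasurable
      (Filter.Eventually.of_forall fun u => ?_)
    rw [Real.norm_of_nonneg (hk0 _)]; exact hk1 _
  have hconv : convolution (fun u => ‖φ u‖) k (ContinuousLinearMap.mul ℝ ℝ) volume t =
      ∫ u, ‖φ u‖ * k (t - u) := rfl
  rw [hconv]
  have hexp : ∀ x : ℝ, ‖Complex.exp (-z * x)‖ = Real.exp (-(z.re * x)) := fun x => by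
    rw [Complex.norm_exp]; simp
  have hbound : ∀ s ≤ t, ‖g t‖ ≤ Real.exp (z.re * (t - s)) * C + ∫ u, ‖φ u‖ * k (t - u) := by
    intro s hs
    have h1 := (h.exp_mul (-z)).eq_add_integral s t
    have h2 : Real.exp (-(z.re * t)) * ‖g t‖ ≤ Real.exp (-(z.re * s)) * C +
        ∫ u in s..t, Real.exp (-(z.re * u)) * ‖φ u‖ := by
      rw [← hexp, ← norm_mul, h1]
      refine (norm_add_le _ _).trans (add_le_add ?_ ?_)
      · rw [norm_mul, hexp]
        exact mul_le_mul_of_nonneg_left (hC s) (Real.exp_pos _).le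
      · refine (intervalIntegral.norm_integral_le_integral_norm hs).trans_eq ?_
        refine intervalIntegral.integral_congr fun u _ => ?_
        rw [← hexp, ← norm_mul]
        congr 1; ring
    have h3 : ∫ u in s..t, Real.exp (z.re * (t - u)) * ‖φ u‖ ≤ ∫ u, ‖φ u‖ * k (t - u) := by
      rw [intervalIntegral.integral_of_le hs]
      refine le_trans (le_of_eq ?_) (setIntegral_le_integral (s := Set.Ioc s t) hint
        (Filter.Eventually.of_forall fun u => mul_nonneg (norm_nonneg _) (hk0 _)))
      refine setIntegral_congr_fun measurableSet_Ioc fun u hu => ?_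
      have : (0 : ℝ) ≤ t - u := sub_nonneg.2 hu.2
      simp [hk, Set.indicator_of_mem (Set.mem_Ici.2 this), mul_comm]
    have h4 : Real.exp (z.re * t) * ∫ u in s..t, Real.exp (-(z.re * u)) * ‖φ u‖ =
        ∫ u in s..t, Real.exp (z.re * (t - u)) * ‖φ u‖ := by
      rw [← intervalIntegral.integral_const_mul]
      refine intervalIntegral.integral_congr fun u _ => ?_
      rw [← mul_assoc, ← Real.exp_add]; ring_nf
    have h5 := mul_le_mul_of_nonneg_left h2 (Real.exp_pos (z.re * t)).le
    rw [mul_add, h4, ← mul_assoc, ← mul_assoc, ← Real.exp_add, ← Real.exp_add,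
      add_neg_cancel, Real.exp_zero, one_mul] at h5
    rw [mul_sub, sub_eq_add_neg]
    linarith
  refine ge_of_tendsto (f := fun s => Real.exp (z.re * (t - s)) * C + ∫ u, ‖φ u‖ * k (t - u))
    ?_ ((Filter.eventually_le_atBot t).mono hbound)
  have hl : Filter.Tendsto (fun s : ℝ => z.re * (t - s)) Filter.atBot Filter.atBot := by
    refine Filter.Tendsto.const_mul_atTop_of_neg hz ?_
    exact (Filter.tendsto_atTop_add_const_left _ t Filter.tendsto_neg_atBot_atTop).congr
      fun s => (sub_eq_add_neg t s).symm
  simpa using ((Real.tendsto_exp_atBot.comp hl).mul_const C).add_const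
    (∫ u, ‖φ u‖ * k (t - u))

theorem integrable_of_re_neg {z : ℂ} (hz : z.re < 0) {φ : ℝ → ℂ} (hφ : Integrable φ)
    (h : IsPrimitive g fun t => z * g t + φ t) {C : ℝ} (hC : ∀ t, ‖g t‖ ≤ C) :
    Integrable g := by
  refine (Integrable.integrable_convolution (ContinuousLinearMap.mul ℝ ℝ) hφ.norm ?_).mono'
    h.continuous.aestronglyMeasurable
    (Filter.Eventually.of_forall (norm_le_convolution hz hφ h hC))
  rw [integrable_indicator_iff measurableSet_Ici, integrableOn_Ici_iff_integrableOn_Ioi]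
  exact integrableOn_exp_mul_Ioi hz 0

theorem eq_zero_of_re_neg {z : ℂ} (hz : z.re < 0)
    (h : IsPrimitive g fun t => z * g t) {C : ℝ} (hC : ∀ t, ‖g t‖ ≤ C) (t : ℝ) : g t = 0 := by
  have := norm_le_convolution hz (φ := fun _ => 0) (integrable_zero _ _ _)
    (by simpa only [add_zero] using h) hC t
  rw [← norm_le_zero_iff]
  refine this.trans_eq ?_
  simp [convolution_def]

end IsPrimitive

/-! ### Bounded solutions of Hurwitz linear systems -/

/-- `f` is a bounded solution on the whole line of `f' = M f + φ`, in the integrated form. -/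
structure IsBoundedSolution {κ : Type*} [Fintype κ] (M : Matrix κ κ ℂ) (φ f : ℝ → κ → ℂ) :
    Prop where
  bounded : ∃ C, ∀ t p, ‖f t p‖ ≤ C
  solves : ∀ p, IsPrimitive (fun t => f t p) (fun t => M.mulVec (f t) p + φ t p)

/-- Induction over the eigenvalues of a matrix: a subspace of row vectors that contains `u` as soon
as it contains `u (M - z)` for some `z` in the open left half-plane is the whole space, if all
eigenvalues of `M` lie in this half-plane. By the Cayley–Hamilton theorem the product of
the factors `M - z` over the roots of the characteristic polynomial vanishes. -/
theorem Submodule.eq_top_of_vecMul_sub_mem {κ : Type*} [Fintype κ] [DecidableEq κ]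
    {M : Matrix κ κ ℂ} (hM : ∀ z ∈ spectrum ℂ M, z.re < 0) (V : Submodule ℂ (κ → ℂ))
    (hV : ∀ z : ℂ, z.re < 0 → ∀ u, Matrix.vecMul u M - z • u ∈ V → u ∈ V) : V = ⊤ := by
  have key : ∀ s : Multiset ℂ, (∀ z ∈ s, z.re < 0) → ∀ u : κ → ℂ,
      Matrix.vecMul u
        (Polynomial.aeval M (s.map fun z => Polynomial.X - Polynomial.C z).prod) ∈ V → u ∈ V := by
    intro s
    induction s using Multiset.induction_on with
    | empty => intro _ u hu; simpa using hu
    | cons z s ih =>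
      intro hs u hu
      refine hV z (hs z (Multiset.mem_cons_self z s)) u
        (ih (fun y hy => hs y (Multiset.mem_cons_of_mem hy)) _ ?_)
      rw [Multiset.map_cons, Multiset.prod_cons, map_mul, ← Matrix.vecMul_vecMul] at hu
      have e : Matrix.vecMul u M - z • u =
          Matrix.vecMul u (Polynomial.aeval M (Polynomial.X - Polynomial.C z)) := by
        simp [Matrix.vecMul_sub, Algebra.algebraMap_eq_smul_one, Matrix.vecMul_smul]
      rw [e]
      exact hu
  rw [eq_top_iff]
  intro u _
  refine key M.charpoly.roots (fun z hz => hM z ?_) u ?_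
  · exact Matrix.mem_spectrum_of_isRoot_charpoly (Polynomial.isRoot_of_mem_roots hz)
  · rw [← (IsAlgClosed.splits M.charpoly).eq_prod_roots_of_monic M.charpoly_monic,
      Matrix.aeval_self_charpoly, Matrix.vecMul_zero]
    exact V.zero_mem

namespace IsBoundedSolution

variable {κ : Type*} [Fintype κ] {M : Matrix κ κ ℂ} {φ f : ℝ → κ → ℂ}

theorem dotProduct (h : IsBoundedSolution M φ f) (u : κ → ℂ) :
    IsPrimitive (fun t => u ⬝ᵥ f t) (fun t => Matrix.vecMul u M ⬝ᵥ f t + u ⬝ᵥ φ t) := by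
  have := IsPrimitive.sum Finset.univ (fun p _ => (h.solves p).const_mul (u p))
  simp only [mul_add, Finset.sum_add_distrib] at this
  simp only [← Matrix.dotProduct_mulVec]
  exact this

theorem exists_norm_dotProduct_le (h : IsBoundedSolution M φ f) (u : κ → ℂ) :
    ∃ C, ∀ t, ‖u ⬝ᵥ f t‖ ≤ C := by
  obtain ⟨C, hC⟩ := h.bounded
  refine ⟨∑ p, ‖u p‖ * C, fun t => (norm_sum_le _ _).trans (Finset.sum_le_sum fun p _ => ?_)⟩
  rw [norm_mul]
  exact mul_le_mul_of_nonneg_left (hC t p) (norm_nonneg _)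

/-- The row vectors `u` for which `u ⬝ᵥ f` is integrable exhaust the space: if `u (M - z)` is such a
vector, then `u ⬝ᵥ f` solves a scalar equation with eigenvalue `z` and integrable forcing. -/
theorem integrable [DecidableEq κ] (h : IsBoundedSolution M φ f)
    (hM : ∀ z ∈ spectrum ℂ M, z.re < 0) (hφ : ∀ p, Integrable fun t => φ t p) (p : κ) :
    Integrable fun t => f t p := by
  let V : Submodule ℂ (κ → ℂ) :=
    { carrier := {u | Integrable fun t => u ⬝ᵥ f t}
      zero_mem' := by simp
      add_mem' := fun hu hv => by
        rw [Set.mem_ofPred_eq] at hu hv ⊢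
        simp only [add_dotProduct]
        exact hu.add hv
      smul_mem' := fun z u hu => by
        rw [Set.mem_ofPred_eq] at hu ⊢
        simp only [smul_dotProduct]
        exact hu.smul z }
  have hV : V = ⊤ := Submodule.eq_top_of_vecMul_sub_mem hM V fun z hz u hu => by
    replace hu : Integrable fun t => (Matrix.vecMul u M - z • u) ⬝ᵥ f t := hu
    change Integrable fun t => u ⬝ᵥ f t
    obtain ⟨C, hC⟩ := h.exists_norm_dotProduct_le u
    have hφu : Integrable fun t => u ⬝ᵥ φ t :=
      integrable_finsetSum _ fun q _ => (hφ q).const_mul (u q)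
    refine IsPrimitive.integrable_of_re_neg hz (hu.add hφu) ?_ hC
    convert h.dotProduct u using 2 with t
    simp only [Pi.add_apply, sub_dotProduct, smul_dotProduct, smul_eq_mul]
    ring
  have hp : Pi.single p (1 : ℂ) ∈ V := by rw [hV]; exact Submodule.mem_top
  have hp' : Integrable fun t => Pi.single p (1 : ℂ) ⬝ᵥ f t := hp
  simpa only [single_one_dotProduct] using hp'

theorem eq_zero [DecidableEq κ] (h : IsBoundedSolution M (fun _ => 0) f)
    (hM : ∀ z ∈ spectrum ℂ M, z.re < 0) (t : ℝ) (p : κ) : f t p = 0 := by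
  let V : Submodule ℂ (κ → ℂ) :=
    { carrier := {u | ∀ t, u ⬝ᵥ f t = 0}
      zero_mem' := by simp
      add_mem' := fun {u v} hu hv t => by rw [add_dotProduct, hu t, hv t, add_zero]
      smul_mem' := fun z u hu t => by rw [smul_dotProduct, hu t, smul_zero] }
  have hV : V = ⊤ := Submodule.eq_top_of_vecMul_sub_mem hM V fun z hz u hu => by
    replace hu : ∀ t, (Matrix.vecMul u M - z • u) ⬝ᵥ f t = 0 := hu
    change ∀ t, u ⬝ᵥ f t = 0
    obtain ⟨C, hC⟩ := h.exists_norm_dotProduct_le u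
    refine IsPrimitive.eq_zero_of_re_neg hz ?_ hC
    convert h.dotProduct u using 2 with t
    have := hu t
    rw [sub_dotProduct, smul_dotProduct, smul_eq_mul, sub_eq_zero] at this
    rw [this, dotProduct_zero, add_zero]
  have hp : Pi.single p (1 : ℂ) ∈ V := by rw [hV]; exact Submodule.mem_top
  simpa only [single_one_dotProduct] using hp t

/-- Two bounded solutions of a Hurwitz system with the same forcing agree. -/
theorem unique [DecidableEq κ] {f' : ℝ → κ → ℂ} (h : IsBoundedSolution M φ f)
    (h' : IsBoundedSolution M φ f') (hM : ∀ z ∈ spectrum ℂ M, z.re < 0) : f = f' := by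
  have hsub : IsBoundedSolution M (fun _ => 0) (fun t p => f t p - f' t p) := by
    obtain ⟨C, hC⟩ := h.bounded
    obtain ⟨C', hC'⟩ := h'.bounded
    refine ⟨⟨C + C', fun t p => (norm_sub_le _ _).trans (add_le_add (hC t p) (hC' t p))⟩,
      fun p s t => ?_⟩
    have e : (fun u => M.mulVec (fun q => f u q - f' u q) p + (0 : κ → ℂ) p) = fun u =>
        (M.mulVec (f u) p + φ u p) - (M.mulVec (f' u) p + φ u p) := by
      funext u
      have : (fun q => f u q - f' u q) = f u - f' u := rfl
      rw [this, Matrix.mulVec_sub]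
      simp
    rw [e]
    refine ⟨((h.solves p s t).1).sub (h'.solves p s t).1, ?_⟩
    rw [intervalIntegral.integral_sub (h.solves p s t).1 (h'.solves p s t).1,
      ← (h.solves p s t).2, ← (h'.solves p s t).2]
    ring
  funext t p
  exact sub_eq_zero.1 (hsub.eq_zero hM t p)

theorem comp_add_right (h : IsBoundedSolution M φ f) (a : ℝ) :
    IsBoundedSolution M (fun t => φ (t + a)) (fun t => f (t + a)) := by
  obtain ⟨C, hC⟩ := h.bounded
  refine ⟨⟨C, fun t p => hC _ p⟩, fun p s t => ⟨?_, ?_⟩⟩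
  · simpa using (h.solves p (s + a) (t + a)).1.comp_add_right a
  · rw [(h.solves p (s + a) (t + a)).2]
    exact (intervalIntegral.integral_comp_add_right
      (fun t => M.mulVec (f t) p + φ t p) a).symm

/-- The transfer relation `(𝐣 ω - M) f̂(ω) = φ̂(ω)`. -/
theorem fourier_eq [DecidableEq κ] (h : IsBoundedSolution M φ f)
    (hM : ∀ z ∈ spectrum ℂ M, z.re < 0) (hφ : ∀ p, Integrable fun t => φ t p) (ω : ℝ) :
    ((Complex.I * ω) • (1 : Matrix κ κ ℂ) - M).mulVec
      (fun p => ∫ t : ℝ, Complex.exp (-(Complex.I * ω * t)) * f t p) =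
      fun p => ∫ t : ℝ, Complex.exp (-(Complex.I * ω * t)) * φ t p := by
  have hf := h.integrable hM hφ
  have hI : ∀ {f : ℝ → ℂ}, Integrable f →
      Integrable fun t : ℝ => Complex.exp (-(Complex.I * ω * t)) * f t := fun hf =>
    hf.bdd_mul (c := 1) (by fun_prop) (Filter.Eventually.of_forall fun t => by
      rw [Complex.norm_exp]; simp)
  have hMf : ∀ p, Integrable fun t => M.mulVec (f t) p := fun p =>
    integrable_finsetSum _ fun q _ => (hf q).const_mul (M p q)
  funext p
  have h1 := (h.solves p).fourier_eq (hf p) ((hMf p).add (hφ p)) ω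
  simp only [mul_add] at h1
  rw [integral_add (hI (hMf p)) (hI (hφ p))] at h1
  have h2 : ∫ t : ℝ, Complex.exp (-(Complex.I * ω * t)) * M.mulVec (f t) p =
      M.mulVec (fun p => ∫ t : ℝ, Complex.exp (-(Complex.I * ω * t)) * f t p) p := by
    simp only [Matrix.mulVec, _root_.dotProduct, Finset.mul_sum]
    rw [integral_finsetSum]
    · refine Finset.sum_congr rfl fun q _ => ?_
      rw [← integral_const_mul]
      congr 1; funext t; ring
    · intro q _
      exact hI ((hf q).const_mul (M p q))
  rw [h2] at h1
  rw [Matrix.sub_mulVec, Matrix.smul_mulVec, Matrix.one_mulVec]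
  simp only [Pi.sub_apply, Pi.smul_apply, smul_eq_mul]
  rw [← h1]; ring

end IsBoundedSolution

/-! ### Expectations along the paths of a linear stochastic system -/

/-- A process with almost surely continuous paths is jointly measurable up to a null set: it is the
limit of its discretizations at the points of the grids `ℤ / (m + 1)`. -/
theorem aestronglyMeasurable_uncurry_of_ae_continuous {Ω : Type*} [MeasurableSpace Ω]
    {P : Measure Ω} [SFinite P] {x : ℝ → Ω → ℝ} (hm : ∀ t, AEStronglyMeasurable (x t) P)
    (hc : ∀ᵐ o ∂P, Continuous fun t => x t o) :
    AEStronglyMeasurable (fun q : ℝ × Ω => x q.1 q.2) (volume.prod P) := by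
  choose X hXm hX using hm
  have hF : ∀ m : ℕ, Measurable fun q : ℝ × Ω => X ((⌊q.1 * (m + 1)⌋ : ℝ) / (m + 1)) q.2 :=
    fun m => by
    have h1 : Measurable fun r : ℤ × Ω => X ((r.1 : ℝ) / (m + 1)) r.2 :=
      measurable_from_prod_countable_right fun k => (hXm ((k : ℝ) / (m + 1))).measurable
    have h2 : Measurable fun q : ℝ × Ω => (⌊q.1 * (m + 1)⌋, q.2) :=
      (Int.measurable_floor.comp (measurable_fst.mul_const _)).prodMk measurable_snd
    exact h1.comp h2
  refine aestronglyMeasurable_of_tendsto_ae (Filter.atTop (α := ℕ))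
    (fun m => (hF m).aestronglyMeasurable) ?_
  have hgrid : ∀ᵐ o ∂P, ∀ (m : ℕ) (k : ℤ),
      x ((k : ℝ) / (m + 1)) o = X ((k : ℝ) / (m + 1)) o :=
    ae_all_iff.2 fun m => ae_all_iff.2 fun k => hX _
  have hall := Measure.quasiMeasurePreserving_snd (μ := (volume : Measure ℝ)) (ν := P) |>.ae
    (hc.and hgrid)
  filter_upwards [hall] with q hq
  have hlim : Filter.Tendsto (fun m : ℕ => (⌊q.1 * (m + 1)⌋ : ℝ) / (m + 1)) Filter.atTop
      (nhds q.1) := by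
    rw [tendsto_iff_dist_tendsto_zero]
    refine squeeze_zero (fun _ => dist_nonneg) (fun m => ?_)
      tendsto_one_div_add_atTop_nhds_zero_nat
    have hpos : (0 : ℝ) < m + 1 := by positivity
    rw [Real.dist_eq, abs_sub_comm, abs_le]
    have h1 := Int.floor_le (q.1 * (m + 1 : ℝ))
    have h2 := Int.lt_floor_add_one (q.1 * (m + 1 : ℝ))
    constructor
    · have : (⌊q.1 * (m + 1 : ℝ)⌋ : ℝ) / (m + 1) ≤ q.1 := (div_le_iff₀ hpos).2 h1
      have h3 : (0 : ℝ) < 1 / (m + 1) := by positivity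
      linarith
    · rw [sub_le_iff_le_add, ← add_div, le_div_iff₀ hpos]
      linarith
  refine ((hq.1.tendsto q.1).comp hlim).congr fun m => ?_
  exact hq.2 m _

section Expectation

variable {Ω : Type*} [MeasurableSpace Ω] {P : Measure Ω} {Z : Ω → ℝ}

theorem integrable_mul_of_memLp_two {X : Ω → ℝ} (hX : MemLp X 2 P) (hZ : MemLp Z 2 P) :
    Integrable (fun o => X o * Z o) P :=
  hX.integrable_mul hZ

theorem integral_abs_mul_le {X : Ω → ℝ} (hX : MemLp X 2 P) (hZ : MemLp Z 2 P) :
    ∫ o, |X o * Z o| ∂P ≤ ∫ o, X o ^ 2 ∂P + ∫ o, Z o ^ 2 ∂P := by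
  rw [← integral_add hX.integrable_sq hZ.integrable_sq]
  refine integral_mono (hX.integrable_mul hZ).abs (hX.integrable_sq.add hZ.integrable_sq)
    fun o => ?_
  simp only [abs_mul]
  nlinarith [sq_nonneg (|X o| - |Z o|), sq_abs (X o), sq_abs (Z o), sq_nonneg (|X o| + |Z o|)]

variable [IsProbabilityMeasure P]

theorem integrable_uncurry_mul {y : ℝ → Ω → ℝ}
    (hy : AEStronglyMeasurable (fun q : ℝ × Ω => y q.1 q.2) (volume.prod P))
    (hL : ∀ t, MemLp (y t) 2 P) {C : ℝ} (hC : ∀ t, ∫ o, y t o ^ 2 ∂P ≤ C)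
    (hZ : MemLp Z 2 P) (s t : ℝ) :
    Integrable (Function.uncurry fun u o => y u o * Z o)
      ((volume.restrict (Set.uIoc s t)).prod P) := by
  have hy' : AEStronglyMeasurable (Function.uncurry fun u o => y u o * Z o)
      ((volume.restrict (Set.uIoc s t)).prod P) := by
    have hle : (volume.restrict (Set.uIoc s t)).prod P ≪ volume.prod P :=
      Measure.AbsolutelyContinuous.prod Measure.restrict_le_self.absolutelyContinuous
        Measure.AbsolutelyContinuous.rfl
    exact (hy.mono_ac hle).mul hZ.1.comp_snd
  rw [integrable_prod_iff hy']
  refine ⟨Filter.Eventually.of_forall fun u => (hL u).integrable_mul hZ, ?_⟩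
  refine Integrable.mono' (intervalIntegrable_const (c := C + ∫ o, Z o ^ 2 ∂P)).def'
    hy'.norm.integral_prod_right' (Filter.Eventually.of_forall fun u => ?_)
  rw [Real.norm_of_nonneg (integral_nonneg fun _ => norm_nonneg _)]
  exact (integral_abs_mul_le (hL u) hZ).trans (add_le_add_left (hC u) _)

/-- The expectations `𝔼(x(t) Z)` inherit a linear differential equation `x' = M x + v` from the
paths, and they are bounded if the second moments are. -/
theorem isBoundedSolution_expectation {κ : Type*} [Fintype κ] {M : Matrix κ κ ℝ}
    {x v : κ → ℝ → Ω → ℝ} {C : ℝ} (hx : ∀ p t, MemLp (x p t) 2 P)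
    (hxC : ∀ p t, ∫ o, x p t o ^ 2 ∂P ≤ C)
    (hcont : ∀ᵐ o ∂P, ∀ p, Continuous fun t => x p t o)
    (hvm : ∀ p, AEStronglyMeasurable (fun q : ℝ × Ω => v p q.1 q.2) (volume.prod P))
    (hv : ∀ p t, MemLp (v p t) 2 P) (hvC : ∀ p t, ∫ o, v p t o ^ 2 ∂P ≤ C)
    (hsol : ∀ᵐ o ∂P, ∀ p s t,
      x p t o - x p s o = ∫ u in s..t, (M.mulVec (fun q => x q u o) p + v p u o))
    (hZ : MemLp Z 2 P) :
    IsBoundedSolution (M.map Complex.ofReal)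
      (fun t p => ((∫ o, v p t o * Z o ∂P : ℝ) : ℂ))
      (fun t p => ((∫ o, x p t o * Z o ∂P : ℝ) : ℂ)) := by
  refine ⟨⟨C + ∫ o, Z o ^ 2 ∂P, fun t p => ?_⟩, fun p s t => ?_⟩
  · rw [Complex.norm_real]
    exact (norm_integral_le_integral_norm _).trans
      ((integral_abs_mul_le (hx p t) hZ).trans (add_le_add_left (hxC p t) _))
  have hxI : ∀ q, Integrable (Function.uncurry fun u o => x q u o * Z o)
      ((volume.restrict (Set.uIoc s t)).prod P) := fun q =>
    integrable_uncurry_mul (aestronglyMeasurable_uncurry_of_ae_continuous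
      (fun t => (hx q t).1) (hcont.mono fun o h => h q)) (hx q) (hxC q) hZ s t
  have hvI := integrable_uncurry_mul (hvm p) (hv p) (hvC p) hZ s t
  have hFI : Integrable (Function.uncurry fun u o =>
      (M.mulVec (fun q => x q u o) p + v p u o) * Z o)
      ((volume.restrict (Set.uIoc s t)).prod P) := by
    refine ((integrable_finsetSum Finset.univ fun q _ => (hxI q).const_mul (M p q)).add
      hvI).congr (Filter.Eventually.of_forall fun r => ?_)
    simp only [Pi.add_apply, Function.uncurry, Matrix.mulVec, dotProduct, add_mul,
      Finset.sum_mul, mul_assoc]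
  have hE : ∀ u, ∫ o, (M.mulVec (fun q => x q u o) p + v p u o) * Z o ∂P =
      M.mulVec (fun q => ∫ o, x q u o * Z o ∂P) p + ∫ o, v p u o * Z o ∂P := by
    intro u
    have e : ∀ o, (M.mulVec (fun q => x q u o) p + v p u o) * Z o =
        (∑ q, M p q * (x q u o * Z o)) + v p u o * Z o := fun o => by
      simp only [add_mul, Matrix.mulVec, dotProduct, Finset.sum_mul, mul_assoc]
    simp only [e]
    have hi : ∀ q ∈ Finset.univ, Integrable (fun o => M p q * (x q u o * Z o)) P := fun q _ =>
      (integrable_mul_of_memLp_two (hx q u) hZ).const_mul _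
    rw [integral_add (integrable_finsetSum _ hi) (integrable_mul_of_memLp_two (hv p u) hZ),
      integral_finsetSum _ hi]
    simp only [integral_const_mul, Matrix.mulVec, dotProduct]
  have hcast : (fun u => (M.map Complex.ofReal).mulVec
        (fun q => ((∫ o, x q u o * Z o ∂P : ℝ) : ℂ)) p + ((∫ o, v p u o * Z o ∂P : ℝ) : ℂ)) =
      fun u => ((∫ o, (M.mulVec (fun q => x q u o) p + v p u o) * Z o ∂P : ℝ) : ℂ) := by
    funext u
    rw [hE]
    simp [Matrix.mulVec, dotProduct]
  rw [hcast]
  have hint : IntervalIntegrable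
      (fun u => ∫ o, (M.mulVec (fun q => x q u o) p + v p u o) * Z o ∂P) volume s t :=
    intervalIntegrable_iff.2 hFI.integral_prod_left
  refine ⟨⟨hint.1.ofReal, hint.2.ofReal⟩, ?_⟩
  rw [intervalIntegral.integral_ofReal, intervalIntegral_integral_swap hFI, ← Complex.ofReal_sub,
    ← integral_sub (integrable_mul_of_memLp_two (hx p t) hZ) (integrable_mul_of_memLp_two (hx p s) hZ)]
  congr 1
  refine integral_congr_ae ?_
  filter_upwards [hsol] with o ho
  rw [← sub_mul, ho p s t, intervalIntegral.integral_mul_const]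

end Expectation

/-! ### Spectral density of the stationary response -/

/-- The block matrix `I ⊗ v` whose `i`-th column carries the vector `v` in the coordinates of
node `i`. -/
def blockColumn (ι : Type*) [DecidableEq ι] {n : ℕ} (v : Fin n → ℂ) : Matrix (ι × Fin n) ι ℂ :=
  Matrix.of fun p i => if p.1 = i then v p.2 else 0

/-- The transfer matrix `(z - (I ⊗ A + G ⊗ b cᵀ))⁻¹ (I ⊗ b)` from the inputs to the states of the
network. -/
noncomputable def stateTransfer {ι : Type*} [Fintype ι] [DecidableEq ι] {n : ℕ}
    (A : Matrix (Fin n) (Fin n) ℝ) (b c : Fin n → ℝ) (G : Matrix ι ι ℝ) (z : ℂ) :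
    Matrix (ι × Fin n) ι ℂ :=
  (z • (1 : Matrix (ι × Fin n) (ι × Fin n) ℂ) -
    (networkStateMatrix A b c G).map Complex.ofReal)⁻¹ * blockColumn ι fun k => (b k : ℂ)

/-- The transfer matrix from the inputs to the outputs of the network. -/
noncomputable def outputTransfer {ι : Type*} [Fintype ι] [DecidableEq ι] {n : ℕ}
    (A : Matrix (Fin n) (Fin n) ℝ) (b c : Fin n → ℝ) (G : Matrix ι ι ℝ) (z : ℂ) : Matrix ι ι ℂ :=
  (blockColumn ι fun k => (c k : ℂ)).transpose * stateTransfer A b c G z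

theorem IsHurwitz.isUnit_det {κ : Type*} [Fintype κ] [DecidableEq κ] {M : Matrix κ κ ℝ}
    (hM : IsHurwitz M) {z : ℂ} (hz : 0 ≤ z.re) :
    IsUnit (z • (1 : Matrix κ κ ℂ) - M.map Complex.ofReal).det := by
  rw [← Matrix.isUnit_iff_isUnit_det]
  by_contra h
  refine (hM z ?_).not_ge hz
  rwa [spectrum.mem_iff, Algebra.algebraMap_eq_smul_one]

/-- Time reversal conjugates the Fourier transform of a real function. -/
theorem spectralDensity_comp_neg (r : ℝ → ℝ) (ω : ℝ) :
    spectralDensity (fun t => r (-t)) ω = star (spectralDensity r ω) := by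
  rw [spectralDensity, spectralDensity, Complex.star_def, ← integral_conj, ← integral_neg_eq_self]
  congr 1
  funext t
  rw [map_mul, ← Complex.exp_conj]
  simp

section Network

variable {Ω ι : Type*} [MeasurableSpace Ω] {P : Measure Ω} [DecidableEq ι] {n : ℕ}
  {A : Matrix (Fin n) (Fin n) ℝ} {b c : Fin n → ℝ} {G : Matrix ι ι ℝ}
  {w : ι → ℝ → Ω → ℝ} {R : ℝ → ℝ} {x : ι × Fin n → ℝ → Ω → ℝ}

theorem IsInputNoise.integral_mul (hw : IsInputNoise P w R) (i k : ι) (s t : ℝ) :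
    ∫ o, w k t o * w i s o ∂P = if k = i then R (t - s) else 0 := by
  split_ifs with h
  · subst h
    rw [← hw.autocorrelation k s (t - s), add_sub_cancel]
    simp only [mul_comm]
  · exact hw.uncorrelated k i h t s

theorem IsInputNoise.crossCorrelation_self (hw : IsInputNoise P w R) (i : ι) :
    crossCorrelation P (w i) (w i) = R := by
  funext τ
  rw [crossCorrelation, correlationAt, hw.integral_mul, if_pos rfl]
  congr 1; ring

theorem IsInputNoise.integrable_forcing (hw : IsInputNoise P w R) (i : ι) (p : ι × Fin n) :
    Integrable fun t => blockColumn ι (fun k => (b k : ℂ)) p i * (R (t - 0) : ℂ) := by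
  simp only [sub_zero]
  exact hw.integrable.ofReal.const_mul _

variable [Fintype ι]

namespace IsStationaryResponse

theorem crossCorrelation_networkOutput (hx : IsStationaryResponse P A b c G w x) (i k : ι) :
    crossCorrelation P (networkOutput c x i) (networkOutput c x k) =
      fun τ => ∑ a, ∑ e, c a * c e * ∫ o, x (i, a) τ o * x (k, e) 0 o ∂P := by
  funext τ
  have hstat : ∀ a e, ∫ o, x (i, a) τ o * x (k, e) 0 o ∂P =
      ∫ o, x (i, a) 0 o * x (k, e) (0 - τ) o ∂P := fun a e => by
    have := hx.wss.correlation_eq (i, a) (k, e) τ 0 τ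
    rwa [correlationAt, correlationAt, sub_self] at this
  have hi : ∀ a e, Integrable
      (fun o => c a * c e * (x (i, a) 0 o * x (k, e) (0 - τ) o)) P := fun a e =>
    (integrable_mul_of_memLp_two (hx.wss.memLp _ _) (hx.wss.memLp _ _)).const_mul _
  simp only [hstat, crossCorrelation, correlationAt, networkOutput, Finset.sum_mul_sum]
  simp only [← integral_const_mul]
  rw [← Finset.sum_congr rfl fun a _ => integral_finsetSum _ fun e _ => hi a e,
    ← integral_finsetSum _ fun a _ => integrable_finsetSum _ fun e _ => hi a e]
  congr 1
  funext o
  exact Finset.sum_congr rfl fun a _ => Finset.sum_congr rfl fun e _ => by ring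

variable [IsProbabilityMeasure P]

/-- The correlations `𝔼(x(t) Z)` of the response with a square integrable `Z` form a bounded solution
of the network equation driven by the correlations `𝔼(w(t) Z)` of the input. -/
theorem isBoundedSolution (hx : IsStationaryResponse P A b c G w x) (hw : IsInputNoise P w R)
    {Z : Ω → ℝ} (hZ : MemLp Z 2 P) :
    IsBoundedSolution ((networkStateMatrix A b c G).map Complex.ofReal)
      (fun t p => ((b p.2 * ∫ o, w p.1 t o * Z o ∂P : ℝ) : ℂ))
      (fun t p => ((∫ o, x p t o * Z o ∂P : ℝ) : ℂ)) := by
  have hx2 : ∀ p t, ∫ o, x p t o ^ 2 ∂P = ∫ o, x p 0 o ^ 2 ∂P := fun p t => by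
    simpa only [correlationAt, sub_zero, ← sq] using hx.wss.correlation_eq p p t 0 0
  have hw2 : ∀ (p : ι × Fin n) t, ∫ o, (b p.2 * w p.1 t o) ^ 2 ∂P = b p.2 ^ 2 * R 0 := by
    intro p t
    have := hw.integral_mul p.1 p.1 t t
    rw [if_pos rfl, sub_self] at this
    simp only [mul_pow, integral_const_mul]
    rw [← this]
    simp only [sq]
  have h0 : ∀ p, 0 ≤ ∫ o, x p 0 o ^ 2 ∂P + b p.2 ^ 2 * R 0 := fun p => by
    rw [← hw2 p 0]
    exact add_nonneg (integral_nonneg fun _ => sq_nonneg _) (integral_nonneg fun _ => sq_nonneg _)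
  have hle : ∀ p, ∫ o, x p 0 o ^ 2 ∂P + b p.2 ^ 2 * R 0 ≤
      ∑ q, (∫ o, x q 0 o ^ 2 ∂P + b q.2 ^ 2 * R 0) := fun p =>
    Finset.single_le_sum (fun q _ => h0 q) (Finset.mem_univ p)
  have hx0 : ∀ p, 0 ≤ ∫ o, x p 0 o ^ 2 ∂P := fun p => integral_nonneg fun _ => sq_nonneg _
  have hw0 : ∀ p : ι × Fin n, 0 ≤ b p.2 ^ 2 * R 0 := fun p => by
    rw [← hw2 p 0]; exact integral_nonneg fun _ => sq_nonneg _
  have := isBoundedSolution_expectation (M := networkStateMatrix A b c G)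
    (v := fun p t o => b p.2 * w p.1 t o)
    hx.wss.memLp (fun p t => (hx2 p t).trans_le ((le_add_of_nonneg_right (hw0 p)).trans (hle p)))
    hx.continuous
    (fun p => ((hw.measurable p.1).const_mul _).aestronglyMeasurable)
    (fun p t => (hw.memLp p.1 t).const_mul _)
    (fun p t => (hw2 p t).trans_le ((le_add_of_nonneg_left (hx0 p)).trans (hle p)))
    (hx.solves.mono fun o h p s t => (h p s t).2) hZ
  simpa only [mul_assoc, integral_const_mul] using this

theorem isBoundedSolution_input (hx : IsStationaryResponse P A b c G w x)
    (hw : IsInputNoise P w R) (i : ι) (s : ℝ) :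
    IsBoundedSolution ((networkStateMatrix A b c G).map Complex.ofReal)
      (fun t p => blockColumn ι (fun k => (b k : ℂ)) p i * (R (t - s) : ℂ))
      (fun t p => ((∫ o, x p t o * w i s o ∂P : ℝ) : ℂ)) := by
  convert hx.isBoundedSolution hw (hw.memLp i s) using 3 with t p
  rw [hw.integral_mul]
  by_cases h : p.1 = i <;> simp [blockColumn, h]

/-- The response and the input are jointly stationary. This is not part of the assumptions; it holds
because bounded solutions of a Hurwitz system are unique. -/
theorem integral_mul_input_eq (hx : IsStationaryResponse P A b c G w x)
    (hw : IsInputNoise P w R) (hM : IsHurwitz (networkStateMatrix A b c G))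
    (i : ι) (p : ι × Fin n) (s t : ℝ) :
    ∫ o, x p t o * w i s o ∂P = ∫ o, x p (t - s) o * w i 0 o ∂P := by
  have h0 := (hx.isBoundedSolution_input hw i 0).comp_add_right (-s)
  simp only [← sub_eq_add_neg, sub_zero] at h0
  have := congrFun (congrFun ((hx.isBoundedSolution_input hw i s).unique h0 hM) t) p
  exact_mod_cast this

theorem integrable_integral_mul_input (hx : IsStationaryResponse P A b c G w x)
    (hw : IsInputNoise P w R) (hM : IsHurwitz (networkStateMatrix A b c G))
    (i : ι) (p : ι × Fin n) :
    Integrable fun t => ((∫ o, x p t o * w i 0 o ∂P : ℝ) : ℂ) :=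
  (hx.isBoundedSolution_input hw i 0).integrable hM (hw.integrable_forcing i) p

theorem fourier_integral_mul_input (hx : IsStationaryResponse P A b c G w x)
    (hw : IsInputNoise P w R) (hM : IsHurwitz (networkStateMatrix A b c G))
    (i : ι) (p : ι × Fin n) (ω : ℝ) :
    spectralDensity (fun t => ∫ o, x p t o * w i 0 o ∂P) ω =
      spectralDensity R ω * stateTransfer A b c G (Complex.I * ω) p i := by
  have h := (hx.isBoundedSolution_input hw i 0).fourier_eq hM (hw.integrable_forcing i) ω
  have hinv := hM.isUnit_det (z := Complex.I * ω) (by simp)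
  have h' := congrFun (congrArg (Matrix.mulVec ((Complex.I * ω) •
    (1 : Matrix (ι × Fin n) (ι × Fin n) ℂ) -
      (networkStateMatrix A b c G).map Complex.ofReal)⁻¹) h) p
  rw [Matrix.mulVec_mulVec, Matrix.nonsing_inv_mul _ hinv, Matrix.one_mulVec] at h'
  have hφ : ∀ q, ∫ t : ℝ, Complex.exp (-(Complex.I * ω * t)) *
      (blockColumn ι (fun k => (b k : ℂ)) q i * (R (t - 0) : ℂ)) =
      blockColumn ι (fun k => (b k : ℂ)) q i * spectralDensity R ω := fun q => by
    rw [spectralDensity, ← integral_const_mul]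
    congr 1
    funext t
    rw [sub_zero]; ring
  simp only [hφ] at h'
  rw [spectralDensity, h', stateTransfer, Matrix.mul_apply, Matrix.mulVec, dotProduct,
    Finset.mul_sum]
  exact Finset.sum_congr rfl fun q _ => by ring

theorem integral_input_mul_eq (hx : IsStationaryResponse P A b c G w x)
    (hw : IsInputNoise P w R) (hM : IsHurwitz (networkStateMatrix A b c G))
    (i : ι) (q : ι × Fin n) (t : ℝ) :
    ∫ o, w i t o * x q 0 o ∂P = ∫ o, x q (-t) o * w i 0 o ∂P := by
  rw [← zero_sub, ← hx.integral_mul_input_eq hw hM]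
  simp only [mul_comm]

theorem integrable_forcing_state (hx : IsStationaryResponse P A b c G w x)
    (hw : IsInputNoise P w R) (hM : IsHurwitz (networkStateMatrix A b c G))
    (q p : ι × Fin n) :
    Integrable fun t => ((b p.2 * ∫ o, w p.1 t o * x q 0 o ∂P : ℝ) : ℂ) := by
  simp only [hx.integral_input_mul_eq hw hM, Complex.ofReal_mul]
  exact (hx.integrable_integral_mul_input hw hM p.1 q).comp_neg.const_mul _

theorem integrable_integral_mul_state (hx : IsStationaryResponse P A b c G w x)
    (hw : IsInputNoise P w R) (hM : IsHurwitz (networkStateMatrix A b c G))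
    (p q : ι × Fin n) :
    Integrable fun t => ∫ o, x p t o * x q 0 o ∂P := by
  have := (hx.isBoundedSolution hw (hx.wss.memLp q 0)).integrable hM
    (hx.integrable_forcing_state hw hM q) p
  simpa using this.re

/-- The spectral density matrix of the states is `S_w Φ Φᴴ`, where `Φ` is the transfer matrix from
the inputs to the states. -/
theorem fourier_integral_mul_state (hx : IsStationaryResponse P A b c G w x)
    (hw : IsInputNoise P w R) (hM : IsHurwitz (networkStateMatrix A b c G))
    (p q : ι × Fin n) (ω : ℝ) :
    spectralDensity (fun t => ∫ o, x p t o * x q 0 o ∂P) ω =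
      star (spectralDensity R ω) * (stateTransfer A b c G (Complex.I * ω) *
        (stateTransfer A b c G (Complex.I * ω)).conjTranspose) p q := by
  have h := (hx.isBoundedSolution hw (hx.wss.memLp q 0)).fourier_eq hM
    (hx.integrable_forcing_state hw hM q) ω
  have hinv := hM.isUnit_det (z := Complex.I * ω) (by simp)
  have hforce : (fun p : ι × Fin n => ∫ t : ℝ, Complex.exp (-(Complex.I * ω * t)) *
      ((b p.2 * ∫ o, w p.1 t o * x q 0 o ∂P : ℝ) : ℂ)) =
      star (spectralDensity R ω) • (blockColumn ι fun k => (b k : ℂ)).mulVec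
        fun i => star (stateTransfer A b c G (Complex.I * ω) q i) := by
    funext p
    have h1 := spectralDensity_comp_neg (fun t => ∫ o, x q t o * w p.1 0 o ∂P) ω
    rw [hx.fourier_integral_mul_input hw hM, spectralDensity] at h1
    have h2 : ∀ t : ℝ, Complex.exp (-(Complex.I * ω * t)) *
        ((b p.2 * ∫ o, w p.1 t o * x q 0 o ∂P : ℝ) : ℂ) =
        b p.2 * (Complex.exp (-(Complex.I * ω * t)) *
          ((∫ o, x q (-t) o * w p.1 0 o ∂P : ℝ) : ℂ)) := fun t => by
      rw [hx.integral_input_mul_eq hw hM, Complex.ofReal_mul]; ring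
    simp only [h2]
    rw [integral_const_mul, h1, star_mul']
    simp only [Pi.smul_apply, Matrix.mulVec, dotProduct, blockColumn, Matrix.of_apply, ite_mul,
      zero_mul, Finset.sum_ite_eq, Finset.mem_univ, if_true, smul_eq_mul]
    ring
  rw [hforce] at h
  have h' := congrFun (congrArg (Matrix.mulVec ((Complex.I * ω) •
    (1 : Matrix (ι × Fin n) (ι × Fin n) ℂ) -
      (networkStateMatrix A b c G).map Complex.ofReal)⁻¹) h) p
  rw [Matrix.mulVec_mulVec, Matrix.nonsing_inv_mul _ hinv, Matrix.one_mulVec,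
    Matrix.mulVec_smul, Matrix.mulVec_mulVec] at h'
  rw [spectralDensity, h']
  rfl

theorem integrable_crossCorrelation (hx : IsStationaryResponse P A b c G w x)
    (hw : IsInputNoise P w R) (hM : IsHurwitz (networkStateMatrix A b c G)) (i k : ι) :
    Integrable (crossCorrelation P (networkOutput c x i) (networkOutput c x k)) := by
  rw [hx.crossCorrelation_networkOutput]
  exact integrable_finsetSum _ fun a _ => integrable_finsetSum _ fun e _ =>
    (hx.integrable_integral_mul_state hw hM _ _).const_mul _

/-- The spectral density matrix of the outputs is `S_w H Hᴴ`, where `H` is the transfer matrix from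
the inputs to the outputs. -/
theorem cpsdMatrix_eq (hx : IsStationaryResponse P A b c G w x)
    (hw : IsInputNoise P w R) (hM : IsHurwitz (networkStateMatrix A b c G)) (ω : ℝ) :
    cpsdMatrix P (networkOutput c x) ω = star (spectralDensity R ω) •
      (outputTransfer A b c G (Complex.I * ω) *
        (outputTransfer A b c G (Complex.I * ω)).conjTranspose) := by
  ext i k
  have hI : ∀ p q : ι × Fin n, Integrable fun t : ℝ => Complex.exp (-(Complex.I * ω * t)) *
      ((∫ o, x p t o * x q 0 o ∂P : ℝ) : ℂ) := fun p q =>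
    (hx.integrable_integral_mul_state hw hM p q).ofReal.bdd_mul (c := 1) (by fun_prop)
      (Filter.Eventually.of_forall fun t => by rw [Complex.norm_exp]; simp)
  have h1 : cpsdMatrix P (networkOutput c x) ω i k = ∑ a, ∑ e, (c a * c e : ℂ) *
      spectralDensity (fun t => ∫ o, x (i, a) t o * x (k, e) 0 o ∂P) ω := by
    rw [cpsdMatrix, Matrix.of_apply, hx.crossCorrelation_networkOutput]
    simp only [spectralDensity]
    simp_rw [← integral_const_mul (c _ * c _ : ℂ)]
    rw [← Finset.sum_congr rfl fun a _ => integral_finsetSum _ fun e _ =>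
        (hI (i, a) (k, e)).const_mul (c a * c e : ℂ),
      ← integral_finsetSum _ fun a _ => integrable_finsetSum _ fun e _ =>
        (hI (i, a) (k, e)).const_mul (c a * c e : ℂ)]
    congr 1
    funext t
    push_cast
    simp only [Finset.mul_sum]
    exact Finset.sum_congr rfl fun a _ => Finset.sum_congr rfl fun e _ => by ring
  have h2 : ∀ i l : ι, outputTransfer A b c G (Complex.I * ω) i l =
      ∑ a, (c a : ℂ) * stateTransfer A b c G (Complex.I * ω) (i, a) l := by
    intro i l
    rw [outputTransfer, Matrix.mul_apply, Fintype.sum_prod_type]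
    simp [blockColumn]
  rw [h1, Matrix.smul_apply, Matrix.mul_apply]
  simp only [hx.fourier_integral_mul_state hw hM, Matrix.conjTranspose_apply, h2, Matrix.mul_apply,
    star_sum, Finset.sum_mul_sum, smul_eq_mul, star_mul', Complex.star_def, Complex.conj_ofReal]
  simp only [Finset.mul_sum]
  symm
  rw [Finset.sum_comm]
  refine Finset.sum_congr rfl fun a _ => ?_
  rw [Finset.sum_comm]
  exact Finset.sum_congr rfl fun e _ => Finset.sum_congr rfl fun l _ => by ring

end IsStationaryResponse

end Network

/-! ### Inversion of the spectral density matrix -/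

/-- The inverse `h(z)⁻¹ - G` of the transfer matrix from the inputs to the outputs, where
`h(z)⁻¹ = det(z - A) / (cᵀ adj(z - A) b)` also makes sense at the eigenvalues of `A`. -/
noncomputable def inverseTransfer {ι : Type*} [DecidableEq ι] {n : ℕ}
    (A : Matrix (Fin n) (Fin n) ℝ) (b c : Fin n → ℝ) (G : Matrix ι ι ℝ) (z : ℂ) : Matrix ι ι ℂ :=
  ((z • (1 : Matrix (Fin n) (Fin n) ℂ) - A.map Complex.ofReal).det / nodalNumerator A b c z) •
    (1 : Matrix ι ι ℂ) - G.map Complex.ofReal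

section Algebra

variable {ι : Type*} [Fintype ι] [DecidableEq ι] {n : ℕ}
  (A : Matrix (Fin n) (Fin n) ℝ) (b c : Fin n → ℝ) (G : Matrix ι ι ℝ) (z : ℂ)

/-- The identity `(z - M) (I ⊗ adj(z - A) b) = (I ⊗ b) (det(z - A) - cᵀ adj(z - A) b G)` for the
network state matrix `M`. It inverts the transfer matrix without dividing by `det(z - A)`, which may
vanish. -/
theorem sub_networkStateMatrix_mul_blockColumn_adjugate :
    (z • (1 : Matrix (ι × Fin n) (ι × Fin n) ℂ) -
        (networkStateMatrix A b c G).map Complex.ofReal) *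
      blockColumn ι ((Matrix.adjugate (z • (1 : Matrix (Fin n) (Fin n) ℂ) -
        A.map Complex.ofReal)).mulVec fun k => (b k : ℂ)) =
    blockColumn ι (fun k => (b k : ℂ)) *
      ((z • (1 : Matrix (Fin n) (Fin n) ℂ) - A.map Complex.ofReal).det • (1 : Matrix ι ι ℂ) -
        nodalNumerator A b c z • G.map Complex.ofReal) := by
  set Az := z • (1 : Matrix (Fin n) (Fin n) ℂ) - A.map Complex.ofReal with hAz
  set v := (Matrix.adjugate Az).mulVec fun k => (b k : ℂ) with hv
  have hadj : Az.mulVec v = Az.det • fun k => (b k : ℂ) := by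
    rw [hv, Matrix.mulVec_mulVec, Matrix.mul_adjugate, Matrix.smul_mulVec, Matrix.one_mulVec]
  have hnum : nodalNumerator A b c z = ∑ e, (c e : ℂ) * v e := rfl
  ext ⟨k, a⟩ i
  have hL : ((z • (1 : Matrix (ι × Fin n) (ι × Fin n) ℂ) -
        (networkStateMatrix A b c G).map Complex.ofReal) * blockColumn ι v) (k, a) i =
      ∑ e, ((if k = i then Az a e else 0) - G k i * (b a * c e)) * v e := by
    rw [Matrix.mul_apply, Fintype.sum_prod_type, Finset.sum_eq_single i]
    · refine Finset.sum_congr rfl fun e _ => ?_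
      by_cases hki : k = i
      · subst hki
        by_cases hae : a = e <;>
          simp [blockColumn, networkStateMatrix, Matrix.vecMulVec_apply, hAz, hae] <;>
          exact Or.inl (by ring)
      · simp [blockColumn, networkStateMatrix, Matrix.vecMulVec_apply, hki]
    · intro l _ hl
      exact Finset.sum_eq_zero fun e _ => by simp [blockColumn, hl]
    · simp
  have hR : (blockColumn ι (fun k => (b k : ℂ)) * (Az.det • (1 : Matrix ι ι ℂ) -
        nodalNumerator A b c z • G.map Complex.ofReal)) (k, a) i =
      b a * ((if k = i then Az.det else 0) - nodalNumerator A b c z * G k i) := by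
    rw [Matrix.mul_apply, Finset.sum_eq_single k]
    · simp [blockColumn, Matrix.one_apply]
    · intro l _ hl
      simp [blockColumn, hl.symm]
    · simp
  have hadj' : ∑ e, Az a e * v e = Az.det * b a := congrFun hadj a
  rw [hL, hR, hnum]
  have hsplit : ∑ e, ((if k = i then Az a e else 0) - G k i * (b a * c e)) * v e =
      (if k = i then ∑ e, Az a e * v e else 0) - G k i * b a * ∑ e, (c e : ℂ) * v e := by
    rw [Finset.mul_sum]
    split_ifs
    · rw [← Finset.sum_sub_distrib]
      exact Finset.sum_congr rfl fun e _ => by ring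
    · rw [zero_sub, ← Finset.sum_neg_distrib]
      exact Finset.sum_congr rfl fun e _ => by ring
  rw [hsplit, hadj']
  split_ifs <;> ring

variable {A b c G z}

theorem outputTransfer_mul_inverseTransfer
    (hz : IsUnit (z • (1 : Matrix (ι × Fin n) (ι × Fin n) ℂ) -
        (networkStateMatrix A b c G).map Complex.ofReal).det)
    (hnode : nodalNumerator A b c z ≠ 0) :
    outputTransfer A b c G z * inverseTransfer A b c G z = 1 := by
  have hK : inverseTransfer A b c G z = (nodalNumerator A b c z)⁻¹ •
      ((z • (1 : Matrix (Fin n) (Fin n) ℂ) - A.map Complex.ofReal).det • (1 : Matrix ι ι ℂ) -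
        nodalNumerator A b c z • G.map Complex.ofReal) := by
    rw [inverseTransfer, smul_sub, smul_smul, smul_smul, inv_mul_cancel₀ hnode, one_smul,
      div_eq_inv_mul]
  have hcol : (blockColumn ι fun k => (c k : ℂ)).transpose *
      blockColumn ι ((Matrix.adjugate (z • (1 : Matrix (Fin n) (Fin n) ℂ) -
        A.map Complex.ofReal)).mulVec fun k => (b k : ℂ)) =
      nodalNumerator A b c z • (1 : Matrix ι ι ℂ) := by
    ext i k
    rw [Matrix.mul_apply, Fintype.sum_prod_type, Finset.sum_eq_single i]
    · by_cases hik : i = k <;>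
        simp [blockColumn, hik, nodalNumerator, dotProduct]
    · intro l _ hl
      exact Finset.sum_eq_zero fun e _ => by simp [blockColumn, hl]
    · simp
  rw [hK, outputTransfer, stateTransfer, Matrix.mul_smul, Matrix.mul_assoc, Matrix.mul_assoc,
    ← sub_networkStateMatrix_mul_blockColumn_adjugate, Matrix.nonsing_inv_mul_cancel_left _ _ hz,
    hcol, smul_smul, inv_mul_cancel₀ hnode, one_smul]

/-- Deleting row and column `j` of the network matrix deletes the `j`-th summand from the diagonal
entries of `Kᴴ K`, where `K` is the inverse transfer matrix. -/
theorem conjTranspose_mul_inverseTransfer_apply (j : ι) (i : {k : ι // k ≠ j}) :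
    ((inverseTransfer A b c G z).conjTranspose * inverseTransfer A b c G z) i i =
      (G j i : ℂ) ^ 2 +
        ((inverseTransfer A b c (groundedMatrix G j) z).conjTranspose *
          inverseTransfer A b c (groundedMatrix G j) z) i i := by
  rw [Matrix.mul_apply, Fintype.sum_eq_add_sum_subtype_ne _ j, Matrix.mul_apply]
  congr 1
  · have : inverseTransfer A b c G z j i = -(G j i : ℂ) := by
      simp [inverseTransfer, i.2.symm]
    simp [Matrix.conjTranspose_apply, this, sq]
  · refine Finset.sum_congr rfl fun k _ => ?_
    have : inverseTransfer A b c G z k i = inverseTransfer A b c (groundedMatrix G j) z k i := by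
      simp [inverseTransfer, groundedMatrix, Matrix.one_apply, Subtype.ext_iff]
    rw [Matrix.conjTranspose_apply, Matrix.conjTranspose_apply, this]

end Algebra

/-- The inverse of the spectral density matrix `S_w H Hᴴ` is `S_w⁻¹ Kᴴ K` with `K = H⁻¹`. -/
theorem IsStationaryResponse.cpsdMatrix_mul {Ω ι : Type*} [MeasurableSpace Ω] {P : Measure Ω}
    [IsProbabilityMeasure P] [Fintype ι] [DecidableEq ι] {n : ℕ}
    {A : Matrix (Fin n) (Fin n) ℝ} {b c : Fin n → ℝ} {G : Matrix ι ι ℝ}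
    {w : ι → ℝ → Ω → ℝ} {R : ℝ → ℝ} {x : ι × Fin n → ℝ → Ω → ℝ}
    (hx : IsStationaryResponse P A b c G w x) (hw : IsInputNoise P w R)
    (hM : IsHurwitz (networkStateMatrix A b c G)) {ω : ℝ} (hS : 0 < spectralDensity R ω)
    (hnode : nodalNumerator A b c (Complex.I * ω) ≠ 0) :
    cpsdMatrix P (networkOutput c x) ω * ((spectralDensity R ω)⁻¹ •
      ((inverseTransfer A b c G (Complex.I * ω)).conjTranspose *
        inverseTransfer A b c G (Complex.I * ω))) = 1 := by
  have hstar : star (spectralDensity R ω) = spectralDensity R ω :=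
    (IsSelfAdjoint.of_nonneg hS.le).star_eq
  have hHK := outputTransfer_mul_inverseTransfer
    (hM.isUnit_det (z := Complex.I * ω) (by simp)) hnode
  have hKH := mul_eq_one_comm.1 hHK
  rw [hx.cpsdMatrix_eq hw hM, hstar, Matrix.smul_mul, Matrix.mul_smul, smul_smul,
    mul_inv_cancel₀ hS.ne', one_smul, Matrix.mul_assoc, ← Matrix.mul_assoc (Matrix.conjTranspose _),
    ← Matrix.conjTranspose_mul, hKH, Matrix.conjTranspose_one, Matrix.one_mul, hHK]

theorem theorem1 {Ω : Type*} [MeasurableSpace Ω] (P : Measure Ω) [IsProbabilityMeasure P]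
    {N n : ℕ} (A : Matrix (Fin n) (Fin n) ℝ) (b c : Fin n → ℝ)
    (G : Matrix (Fin N) (Fin N) ℝ) (hG : ∀ i k, i ≠ k → 0 ≤ G i k)
    (hstab : IsHurwitz (networkStateMatrix A b c G))
    (w : Fin N → ℝ → Ω → ℝ) (Rw : ℝ → ℝ) (hA1 : IsInputNoise P w Rw)
    (W : ℝ) (hA2 : IsExcitationInterval P w W)
    (x : Fin N × Fin n → ℝ → Ω → ℝ) (hx : IsStationaryResponse P A b c G w x)
    (j : Fin N)
    (hstabj : IsHurwitz (networkStateMatrix A b c (groundedMatrix G j)))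
    (xj : {k : Fin N // k ≠ j} × Fin n → ℝ → Ω → ℝ)
    (hxj : IsStationaryResponse P A b c (groundedMatrix G j) (groundedInput w j) xj)
    (ω₀ : ℝ) (hω₀ : ω₀ ∈ Set.Ioo (-W) W)
    (hnode : nodalNumerator A b c (Complex.I * ω₀) ≠ 0) :
    (∀ i k, Integrable (crossCorrelation P (networkOutput c x i) (networkOutput c x k))) ∧
    (∀ i k, Integrable (crossCorrelation P (networkOutput c xj i) (networkOutput c xj k))) ∧
    IsUnit (cpsdMatrix P (networkOutput c x) ω₀) ∧
    IsUnit (cpsdMatrix P (networkOutput c xj) ω₀) ∧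
    ∀ i : {k : Fin N // k ≠ j},
      (G j i : ℂ) =
        (spectralDensity Rw ω₀ *
          ((cpsdMatrix P (networkOutput c x) ω₀)⁻¹ i i -
            (cpsdMatrix P (networkOutput c xj) ω₀)⁻¹ i i)) ^ (1 / 2 : ℂ) := by

  have hwj : IsInputNoise P (groundedInput w j) Rw :=
    { measurable := fun i => hA1.measurable i
      memLp := fun i => hA1.memLp i
      zero_mean := fun i => hA1.zero_mean i
      uncorrelated := fun i k hik => hA1.uncorrelated i k fun h => hik (Subtype.ext h)
      autocorrelation := fun i => hA1.autocorrelation i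
      integrable := hA1.integrable }
  have hS : 0 < spectralDensity Rw ω₀ := by
    rw [← hA1.crossCorrelation_self j]
    exact hA2.2 ω₀ hω₀ j
  have hinv := hx.cpsdMatrix_mul hA1 hstab hS hnode
  have hinvj := hxj.cpsdMatrix_mul hwj hstabj hS hnode
  refine ⟨hx.integrable_crossCorrelation hA1 hstab, hxj.integrable_crossCorrelation hwj hstabj,
    IsUnit.of_mul_eq_one _ hinv, IsUnit.of_mul_eq_one _ hinvj, fun i => ?_⟩
  have hsq : spectralDensity Rw ω₀ * ((cpsdMatrix P (networkOutput c x) ω₀)⁻¹ i i -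
      (cpsdMatrix P (networkOutput c xj) ω₀)⁻¹ i i) = (G j i : ℂ) ^ 2 := by
    rw [Matrix.inv_eq_right_inv hinv, Matrix.inv_eq_right_inv hinvj, Matrix.smul_apply,
      Matrix.smul_apply, conjTranspose_mul_inverseTransfer_apply j i, ← smul_sub, smul_eq_mul,
      mul_inv_cancel_left₀ hS.ne', add_sub_cancel_right]
  rw [hsq]
  have hg : 0 ≤ G j i := hG j i i.2.symm
  -- the square is a nonnegative real, so the principal complex square root is the real one
  rw [← Complex.ofReal_pow, show (1 / 2 : ℂ) = ((1 / 2 : ℝ) : ℂ) by norm_num,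
    ← Complex.ofReal_cpow (sq_nonneg _), ← Real.sqrt_eq_rpow, Real.sqrt_sq hg]
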